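/- For $h\ge 0$ let $T_h$ be the full binary tree of height $h$ (every inner vertex has a left and a right son and all leaves have depth $h$, the root having depth $0$); it has $n=2^{h+1}-1$ vertices. In the problem Strategy of size $n$, a function $f$ assigns a bit to every vertex of $T_h$; Alice knows the values of $f$ at the vertices of odd depth and Bob knows the values of $f$ at the vertices of even depth. The leaf reached by $f$ is the endpoint of the path that starts at the root and always goes down, from a vertex $v$ to its left son if $f(v)=0$ and to its right son if $f(v)=1$. The players have to determine the index of this leaf. In a deterministic protocol, in each round one of the players sends the other a message, a bit string determined by the sender's input and the messages sent so far; the messages exchanged determine the output. Theorem. For every $\varepsilon>0$, Strategy does not admit a deterministic protocol using $O(\log^{1-\varepsilon} n)$ rounds and $O(\log n)$ bits of communication at each round. That is, there is no family of deterministic protocols, one for each size $n=2^{h+1}-1$, such that the protocol for size $n$ outputs the index of the leaf reached on every input $f$, always uses at most $r(n)$ rounds, and sends at most $c(n)$ bits in each round, where $r(n)=O(\log^{1-\varepsilon} n)$ and $c(n)=O(\log n)$. -/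

import Mathlib

open Filter Asymptotics

/-- A deterministic two-party communication protocol in the message (round) model.  Alice holds an
input in `X`, Bob holds an input in `Y`, and the result lies in `Z`.  A protocol either stops with a
result, or prescribes that one of the players sends the other a message of `b` bits which is a
function of the sender's own input (`b`, the sender and the function depend on the messages
exchanged so far); the protocol then continues in a way that depends on the message sent. -/
inductive Protocol (X Y Z : Type) : Type where
  | answer (z : Z) : Protocol X Y Z
  | alice (b : ℕ) (msg : X → (Fin b → Bool)) (next : (Fin b → Bool) → Protocol X Y Z) :
      Protocol X Y Z
  | bob (b : ℕ) (msg : Y → (Fin b → Bool)) (next : (Fin b → Bool) → Protocol X Y Z) :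
      Protocol X Y Z

namespace Protocol

variable {X Y Z : Type}

/-- The result of the execution of the protocol on the inputs `x` and `y`. -/
def output : Protocol X Y Z → X → Y → Z
  | answer z, _, _ => z
  | alice _ msg next, x, y => (next (msg x)).output x y
  | bob _ msg next, x, y => (next (msg y)).output x y

/-- The number of rounds (messages sent) in the execution on the inputs `x` and `y`. -/
def rounds : Protocol X Y Z → X → Y → ℕ
  | answer _, _, _ => 0
  | alice _ msg next, x, y => (next (msg x)).rounds x y + 1
  | bob _ msg next, x, y => (next (msg y)).rounds x y + 1

/-- The largest number of bits sent in a single round of the execution on the inputs `x`, `y`. -/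
def maxBits : Protocol X Y Z → X → Y → ℕ
  | answer _, _, _ => 0
  | alice b msg next, x, y => max b ((next (msg x)).maxBits x y)
  | bob b msg next, x, y => max b ((next (msg y)).maxBits x y)

end Protocol

namespace Strategy

/-- The vertices of the full binary tree of height `h` (all leaves at depth `h`): the pair `⟨d, i⟩`
is the `i`-th vertex from the left, counting from `0`, among the `2 ^ d` vertices of depth `d`. -/
abbrev Vertex (h : ℕ) : Type := Σ d : Fin (h + 1), Fin (2 ^ (d : ℕ))

/-- The size of the problem: the number of vertices of the full binary tree of height `h`. -/
def size (h : ℕ) : ℕ := Fintype.card (Vertex h)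

theorem size_eq (h : ℕ) : size h = 2 ^ (h + 1) - 1 := by
  have key : ∀ m : ℕ, ∑ i ∈ Finset.range m, 2 ^ i = 2 ^ m - 1 := by
    intro m
    have := Nat.geomSum_eq (le_refl 2) m
    simpa using this
  simp only [size, Fintype.card_sigma, Fintype.card_fin]
  rw [Fin.sum_univ_eq_sum_range (fun i => 2 ^ i), key]

/-- The son of the `i`-th vertex of depth `d`: the left one for `false` (the number `0`), the right
one for `true` (the number `1`). -/
def son {d : ℕ} (i : Fin (2 ^ d)) (s : Bool) : Fin (2 ^ (d + 1)) :=
  ⟨2 * (i : ℕ) + s.toNat, by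
    have h1 := i.isLt
    have h2 := s.toNat_le
    rw [pow_succ]
    omega⟩

/-- The vertex of depth `d` on the path which starts at the root and goes downwards, at each vertex
to the left son or to the right son according to the value of `f` there. -/
def pathVertex {h : ℕ} (f : Vertex h → Bool) : (d : ℕ) → d ≤ h → Fin (2 ^ d)
  | 0, _ => 0
  | d + 1, hd =>
      let i := pathVertex f d (Nat.le_of_succ_le hd)
      son i (f ⟨⟨d, Nat.lt_succ_of_le (Nat.le_of_succ_le hd)⟩, i⟩)

/-- The index (from left to right, from `0`) of the leaf reached by `f`. -/
def leafReached {h : ℕ} (f : Vertex h → Bool) : Fin (2 ^ h) := pathVertex f h le_rfl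

/-- Alice's inputs: a bit for each vertex of odd depth. -/
abbrev AliceInput (h : ℕ) : Type := {v : Vertex h // Odd (v.1 : ℕ)} → Bool

/-- Bob's inputs: a bit for each vertex of even depth. -/
abbrev BobInput (h : ℕ) : Type := {v : Vertex h // Even (v.1 : ℕ)} → Bool

/-- The part of `f` known to Alice. -/
def aliceView {h : ℕ} (f : Vertex h → Bool) : AliceInput h := fun v => f v.1

/-- The part of `f` known to Bob. -/
def bobView {h : ℕ} (f : Vertex h → Bool) : BobInput h := fun v => f v.1

/-- The protocol solves the problem on the full binary tree of height `h`, using on every input at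
most `r` rounds and at most `c` bits of communication at each round. -/
def SolvedBy (h : ℕ) (P : Protocol (AliceInput h) (BobInput h) (Fin (2 ^ h))) (r c : ℕ) : Prop :=
  ∀ f : Vertex h → Bool,
    P.output (aliceView f) (bobView f) = leafReached f ∧
    P.rounds (aliceView f) (bobView f) ≤ r ∧
    P.maxBits (aliceView f) (bobView f) ≤ c

end Strategy

-- Strategy contains tree pointer jumping, where two players alternately own the pointers along a
-- path in a tree of large arity, and pointer jumping resists protocols with few rounds. A symbol of
-- `s + 1` bits is written at the even depths of a block of `2 * s + 1` levels of the binary tree.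
-- The odd block length hands the next block to the other player (`blockSymbols_walk_encode`,
-- `solves_of_solvedBy`).
--
-- The lower bound (`not_solves`) is a round elimination on dense rectangles. A message of at most
-- `c` bits costs its sender a factor `2 ^ c` of density. Descending to a suitable subtree repairs
-- the loss: a dense owner has good slices for a quarter of the symbols, and a set of density about
-- `2 ^ (-c)` cannot have small projections at all of them (`Solves.descend_dense`). Each round uses
-- up at most three levels, whence `h < (2 * s + 1) * (3 * r + 1)` once `2 ^ (s + 1) ≥ 12 * (c +
-- 3)`. With `c = O(log n)` this makes `s = O(log log n)`, and the right side is `o(log n)`, whereas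
-- `h` is of order `log n`.

namespace Protocol

variable {X Y Z : Type}

/-- The protocol with the roles of the two players exchanged. -/
def swap : Protocol X Y Z → Protocol Y X Z
  | answer z => answer z
  | alice b msg next => bob b msg fun m => (next m).swap
  | bob b msg next => alice b msg fun m => (next m).swap

theorem output_swap (P : Protocol X Y Z) (x : X) (y : Y) :
    P.swap.output y x = P.output x y := by
  induction P with
  | answer z => rfl
  | alice b msg next ih => exact ih _
  | bob b msg next ih => exact ih _

theorem rounds_swap (P : Protocol X Y Z) (x : X) (y : Y) :
    P.swap.rounds y x = P.rounds x y := by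
  induction P with
  | answer z => rfl
  | alice b msg next ih => simp [swap, rounds, ih]
  | bob b msg next ih => simp [swap, rounds, ih]

theorem maxBits_swap (P : Protocol X Y Z) (x : X) (y : Y) :
    P.swap.maxBits y x = P.maxBits x y := by
  induction P with
  | answer z => rfl
  | alice b msg next ih => simp [swap, maxBits, ih]
  | bob b msg next ih => simp [swap, maxBits, ih]

end Protocol

-- Densities of projections and slices in product spaces

section Density

/-- The inputs of the `i`-th subtree occurring in `A` together with the root pointer `i`. -/
def ownSlice {ι U : Type} [DecidableEq ι] [DecidableEq U] (A : Finset (ι × (ι → U))) (i : ι) : Finset U :=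
  (A.filter fun a => a.1 = i).image fun a => a.2 i

theorem mem_ownSlice {ι U : Type} [DecidableEq ι] [DecidableEq U] {A : Finset (ι × (ι → U))} {i : ι} {u : U} :
    u ∈ ownSlice A i ↔ ∃ x, (i, x) ∈ A ∧ x i = u := by
  simp only [ownSlice, Finset.mem_image, Finset.mem_filter]
  constructor
  · rintro ⟨⟨j, x⟩, ⟨h, rfl⟩, rfl⟩
    exact ⟨x, h, rfl⟩
  · rintro ⟨x, h, rfl⟩
    exact ⟨(i, x), ⟨h, rfl⟩, rfl⟩

variable {ι U V : Type} [Fintype ι] [DecidableEq ι] [Fintype U] [DecidableEq U]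
  [Fintype V] [DecidableEq V]

theorem exists_card_fiber_ge {X : Type} (A : Finset X) {b c : ℕ} (hb : b ≤ c)
    (f : X → (Fin b → Bool)) :
    ∃ m, (A.card : ℝ) / 2 ^ c ≤ ((A.filter fun a => f a = m).card : ℝ) := by
  by_contra! h
  have h1 : A.card = ∑ m, (A.filter fun a => f a = m).card :=
    Finset.card_eq_sum_card_fiberwise (fun x _ => Finset.mem_coe.2 (Finset.mem_univ (f x)))
  have h2 : (A.card : ℝ) < ∑ _m : Fin b → Bool, (A.card : ℝ) / 2 ^ c := by
    conv_lhs => rw [h1]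
    push_cast
    exact Finset.sum_lt_sum_of_nonempty Finset.univ_nonempty fun m _ => h m
  have h3 : (2 : ℝ) ^ b ≤ 2 ^ c := pow_le_pow_right₀ one_le_two hb
  have h4 : (0 : ℝ) ≤ A.card := by positivity
  have h5 : (2 : ℝ) ^ b * ((A.card : ℝ) / 2 ^ c) ≤ A.card := by
    rw [mul_div_assoc', div_le_iff₀ (by positivity), mul_comm]
    gcongr
  simp only [Finset.sum_const, Finset.card_univ, Fintype.card_fun, Fintype.card_bool,
    Fintype.card_fin, nsmul_eq_mul] at h2
  push_cast at h2
  linarith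

/-- `S` lies in the box whose `i`-th side is its projection and whose other sides are full. -/
theorem card_image_eval_le (S : Finset (ι → V)) (i : ι) :
    S.card ≤ (S.image fun y => y i).card * Fintype.card V ^ (Fintype.card ι - 1) := by
  have h : S ⊆ Fintype.piFinset
      (fun j => if j = i then S.image (fun y => y i) else Finset.univ) := by
    intro y hy
    rw [Fintype.mem_piFinset]
    intro j
    split_ifs with hj
    · subst hj
      exact Finset.mem_image_of_mem _ hy
    · exact Finset.mem_univ _
  refine (Finset.card_le_card h).trans (le_of_eq ?_)
  rw [Fintype.card_piFinset, ← Finset.mul_prod_erase _ _ (Finset.mem_univ i)]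
  rw [if_pos rfl]
  congr 1
  rw [Finset.prod_congr rfl (g := fun _ => Fintype.card V)]
  · simp [Finset.card_erase_of_mem]
  · intro j hj
    rw [if_neg (Finset.ne_of_mem_erase hj), Finset.card_univ]

theorem density_image_eval [Nonempty ι] [Nonempty V] (S : Finset (ι → V)) (i : ι) {β : ℝ}
    (hS : β * Fintype.card (ι → V) ≤ S.card) :
    β * Fintype.card V ≤ (S.image fun y => y i).card := by
  have h1 : (S.card : ℝ) ≤
      (S.image fun y => y i).card * (Fintype.card V : ℝ) ^ (Fintype.card ι - 1) := by
    exact_mod_cast card_image_eval_le S i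
  have hV : (0 : ℝ) < Fintype.card V := by exact_mod_cast Fintype.card_pos
  have h2 : (Fintype.card (ι → V) : ℝ) =
      Fintype.card V * (Fintype.card V : ℝ) ^ (Fintype.card ι - 1) := by
    rw [Fintype.card_fun]
    push_cast
    rw [← pow_succ', Nat.sub_add_cancel Fintype.card_pos]
  rw [h2, ← mul_assoc] at hS
  exact le_of_mul_le_mul_right (hS.trans h1) (by positivity)

theorem density_le_sum_ownSlice [Nonempty ι] [Nonempty U] (A : Finset (ι × (ι → U))) {α : ℝ}
    (hA : α * Fintype.card (ι × (ι → U)) ≤ A.card) :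
    α * Fintype.card ι * Fintype.card U ≤ ∑ i, ((ownSlice A i).card : ℝ) := by
  have hU : (0 : ℝ) < Fintype.card U := by exact_mod_cast Fintype.card_pos
  have h1 : A.card = ∑ i, (A.filter fun a => a.1 = i).card :=
    Finset.card_eq_sum_card_fiberwise (fun x _ => Finset.mem_coe.2 (Finset.mem_univ x.1))
  have h2 : ∀ i, (A.filter fun a => a.1 = i).card ≤
      (ownSlice A i).card * Fintype.card U ^ (Fintype.card ι - 1) := by
    intro i
    have h3 : ((A.filter fun a => a.1 = i).image Prod.snd).card =
        (A.filter fun a => a.1 = i).card := by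
      apply Finset.card_image_of_injOn
      rintro ⟨j, x⟩ hx ⟨j', x'⟩ hx' h
      simp only [Finset.coe_filter, Set.mem_ofPred_eq] at hx hx' h
      simp [hx.2, hx'.2, h]
    have h4 := card_image_eval_le ((A.filter fun a => a.1 = i).image Prod.snd) i
    rw [h3, Finset.image_image] at h4
    exact h4
  have h5 : (A.card : ℝ) ≤
      (∑ i, ((ownSlice A i).card : ℝ)) * (Fintype.card U : ℝ) ^ (Fintype.card ι - 1) := by
    rw [h1, Finset.sum_mul]
    push_cast
    exact Finset.sum_le_sum fun i _ => by exact_mod_cast h2 i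
  have h6 : (Fintype.card (ι × (ι → U)) : ℝ) =
      Fintype.card ι * Fintype.card U * (Fintype.card U : ℝ) ^ (Fintype.card ι - 1) := by
    rw [Fintype.card_prod, Fintype.card_fun]
    push_cast
    rw [mul_assoc, ← pow_succ', Nat.sub_add_cancel Fintype.card_pos]
  rw [h6] at hA
  refine le_of_mul_le_mul_right ?_ (pow_pos hU (Fintype.card ι - 1))
  linarith

theorem exists_density_ownSlice [Nonempty ι] [Nonempty U] (A : Finset (ι × (ι → U))) {α : ℝ}
    (hA : α * Fintype.card (ι × (ι → U)) ≤ A.card) :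
    ∃ i, α * Fintype.card U ≤ (ownSlice A i).card := by
  by_contra! h
  have h1 := density_le_sum_ownSlice A hA
  have h2 := Finset.sum_lt_sum_of_nonempty Finset.univ_nonempty fun i (_ : i ∈ Finset.univ) => h i
  simp only [Finset.sum_const, Finset.card_univ, nsmul_eq_mul] at h2
  linarith

/-- If the owner's set has density at least `α + 1 / 4`, then for a quarter of the symbols the slice
has density at least `α`. -/
theorem card_density_ownSlice [Nonempty ι] [Nonempty U] (A : Finset (ι × (ι → U))) {α : ℝ}
    (hα : 0 ≤ α) (hA : (α + 1 / 4) * Fintype.card (ι × (ι → U)) ≤ A.card) :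
    (Fintype.card ι : ℝ) / 4 ≤
      (Finset.univ.filter fun i => α * Fintype.card U ≤ (ownSlice A i).card).card := by
  have hU : (0 : ℝ) < Fintype.card U := by exact_mod_cast Fintype.card_pos
  have h1 := density_le_sum_ownSlice A hA
  -- Averaging: a bad symbol contributes at most `α` to the sum of slice densities, a good one at
  -- most `1`, so the excess `1 / 4` must come from good symbols.
  have h2 : ∀ i, ((ownSlice A i).card : ℝ) ≤ α * Fintype.card U +
      if α * Fintype.card U ≤ (ownSlice A i).card then (Fintype.card U : ℝ) else 0 := by
    intro i
    split_ifs with h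
    · have : ((ownSlice A i).card : ℝ) ≤ Fintype.card U := by
        exact_mod_cast Finset.card_le_univ _
      have : 0 ≤ α * Fintype.card U := by positivity
      linarith
    · linarith
  have h3 := h1.trans (Finset.sum_le_sum fun i (_ : i ∈ Finset.univ) => h2 i)
  rw [Finset.sum_add_distrib, ← Finset.sum_filter] at h3
  simp only [Finset.sum_const, Finset.card_univ, nsmul_eq_mul] at h3
  refine le_of_mul_le_mul_right ?_ hU
  linarith

/-- `S` is contained in the product of its projections; were those at `I` all below density `γ`, its
density would be at most `γ ^ I.card`. -/
theorem exists_density_image_eval [Nonempty V] (S : Finset (ι → V)) (I : Finset ι) {β γ : ℝ}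
    (hβ : γ ^ I.card < β) (hS : β * Fintype.card (ι → V) ≤ S.card) :
    ∃ i ∈ I, γ * Fintype.card V ≤ (S.image fun y => y i).card := by
  by_contra! h
  have hV : (0 : ℝ) < Fintype.card V := by exact_mod_cast Fintype.card_pos
  have h1 : S ⊆ Fintype.piFinset fun i => S.image fun y => y i := by
    intro y hy
    rw [Fintype.mem_piFinset]
    exact fun i => Finset.mem_image_of_mem _ hy
  have h2 : (S.card : ℝ) ≤ ∏ i, ((S.image fun y => y i).card : ℝ) := by
    have := Finset.card_le_card h1
    rw [Fintype.card_piFinset] at this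
    exact_mod_cast this
  have h3 : ∏ i, ((S.image fun y => y i).card : ℝ) ≤
      ∏ i, ((if i ∈ I then γ else 1) * Fintype.card V : ℝ) := by
    refine Finset.prod_le_prod (fun i _ => by positivity) fun i _ => ?_
    split_ifs with hi
    · exact (h i hi).le
    · rw [one_mul]
      exact_mod_cast Finset.card_le_univ _
  rw [Finset.prod_mul_distrib, Finset.prod_ite_mem, Finset.univ_inter] at h3
  simp only [Finset.prod_const, Finset.card_univ] at h3
  rw [Fintype.card_fun] at hS
  push_cast at hS
  have h4 := lt_of_lt_of_le (mul_lt_mul_of_pos_right hβ (pow_pos hV (Fintype.card ι))) hS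
  linarith

end Density

/-! ### Tree pointer jumping -/

namespace PointerJumping

mutual
/-- The inputs, for tree pointer jumping with `k` levels over the alphabet `ι`, of the player who
owns the pointer at the root. -/
def Own (ι : Type) : ℕ → Type
  | 0 => Unit
  | k + 1 => ι × (ι → Oth ι k)
/-- The inputs, for tree pointer jumping with `k` levels over the alphabet `ι`, of the player who
does not own the pointer at the root. -/
def Oth (ι : Type) : ℕ → Type
  | 0 => Unit
  | k + 1 => ι → Own ι k
end

/-- The sequence of the pointers followed. -/
def eval {ι : Type} : (k : ℕ) → Own ι k → Oth ι k → List ι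
  | 0, _, _ => []
  | k + 1, a, b =>
      let a' : ι × (ι → Oth ι k) := a
      let b' : ι → Own ι k := b
      a'.1 :: eval k (b' a'.1) (a'.2 a'.1)

variable {ι : Type}

theorem finite_inputs [Finite ι] (k : ℕ) : Finite (Own ι k) ∧ Finite (Oth ι k) := by
  induction k with
  | zero => exact ⟨inferInstanceAs (Finite Unit), inferInstanceAs (Finite Unit)⟩
  | succ k ih =>
    obtain ⟨_, _⟩ := ih
    exact ⟨inferInstanceAs (Finite (ι × (ι → Oth ι k))), inferInstanceAs (Finite (ι → Own ι k))⟩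

theorem nonempty_inputs [Nonempty ι] (k : ℕ) : Nonempty (Own ι k) ∧ Nonempty (Oth ι k) := by
  induction k with
  | zero => exact ⟨inferInstanceAs (Nonempty Unit), inferInstanceAs (Nonempty Unit)⟩
  | succ k ih =>
    obtain ⟨_, _⟩ := ih
    exact ⟨inferInstanceAs (Nonempty (ι × (ι → Oth ι k))),
      inferInstanceAs (Nonempty (ι → Own ι k))⟩

noncomputable instance [Finite ι] (k : ℕ) : Fintype (Own ι k) :=
  have := (finite_inputs (ι := ι) k).1
  Fintype.ofFinite _

noncomputable instance [Finite ι] (k : ℕ) : Fintype (Oth ι k) :=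
  have := (finite_inputs (ι := ι) k).2
  Fintype.ofFinite _

instance [Nonempty ι] (k : ℕ) : Nonempty (Own ι k) := (nonempty_inputs k).1

instance [Nonempty ι] (k : ℕ) : Nonempty (Oth ι k) := (nonempty_inputs k).2

variable {X Y Z : Type}

/-- After an embedding of the inputs and a decoding of the results, the protocol solves tree pointer
jumping with `k` levels, the root being owned by the first player, on a combinatorial rectangle whose
sides have densities at least `α` and `β`, in at most `r` rounds of at most `c` bits. -/
def Solves (ι : Type) [Fintype ι] (P : Protocol X Y Z) (r c k : ℕ) (α β : ℝ) : Prop :=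
  ∃ (A : Finset (Own ι k)) (S : Finset (Oth ι k)) (φ : Own ι k → X) (ψ : Oth ι k → Y)
    (g : Z → List ι),
    α * Fintype.card (Own ι k) ≤ A.card ∧ β * Fintype.card (Oth ι k) ≤ S.card ∧
    ∀ a ∈ A, ∀ b ∈ S, g (P.output (φ a) (ψ b)) = eval k a b ∧
      P.rounds (φ a) (ψ b) ≤ r ∧ P.maxBits (φ a) (ψ b) ≤ c

/-- `Nat.card` mediates between the `Fintype` instance chosen for `Own` and the one of the product
type. -/
theorem card_own_succ [Fintype ι] (k : ℕ) :
    Fintype.card (Own ι (k + 1)) = Nat.card (ι × (ι → Oth ι k)) :=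
  Fintype.card_eq_nat_card

theorem card_oth_succ [Fintype ι] (k : ℕ) : Fintype.card (Oth ι (k + 1)) = Nat.card (ι → Own ι k) :=
  Fintype.card_eq_nat_card

open Classical in
/-- Passing to the `i`-th subtree. -/
theorem solves_subtree [Fintype ι] {P : Protocol X Y Z} {r c k : ℕ} {α β : ℝ}
    {A : Finset (ι × (ι → Oth ι k))} {S : Finset (ι → Own ι k)}
    {φ : Own ι (k + 1) → X} {ψ : Oth ι (k + 1) → Y} {g : Z → List ι}
    (h : ∀ a ∈ A, ∀ b ∈ S, g (P.output (φ a) (ψ b)) = eval (k + 1) a b ∧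
      P.rounds (φ a) (ψ b) ≤ r ∧ P.maxBits (φ a) (ψ b) ≤ c) (i : ι)
    (hA : α * Fintype.card (Oth ι k) ≤ (ownSlice A i).card)
    (hS : β * Fintype.card (Own ι k) ≤ (S.image fun y => y i).card) :
    Solves ι P.swap r c k β α := by
  have : Nonempty ι := ⟨i⟩
  -- Each player completes a subtree input to a full input in the rectangle without consulting the
  -- other. The first pointer is then `i`, so decoding drops it with `tail`.
  have hσ : ∀ u ∈ S.image (fun y => y i), ∃ y ∈ S, y i = u := fun u hu => Finset.mem_image.1 hu
  have hτ : ∀ u ∈ ownSlice A i, ∃ x, (i, x) ∈ A ∧ x i = u := fun u hu => mem_ownSlice.1 hu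
  choose! σ hσS hσ using hσ
  choose! τ hτA hτ using hτ
  refine ⟨S.image fun y => y i, ownSlice A i, fun u => ψ (σ u), fun u => φ (i, τ u),
    fun z => (g z).tail, hS, hA, fun a ha b hb => ?_⟩
  obtain ⟨h1, h2, h3⟩ := h _ (hτA b hb) _ (hσS a ha)
  rw [Protocol.output_swap, Protocol.rounds_swap, Protocol.maxBits_swap]
  refine ⟨(congrArg List.tail h1).trans ?_, h2, h3⟩
  change eval k (σ a i) (τ b i) = _
  rw [hσ a ha, hτ b hb]

-- Round elimination

variable [Fintype ι] [Nonempty ι]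

theorem nonempty_of_density {U : Type} [Fintype U] [Nonempty U] {A : Finset U} {α : ℝ}
    (hα : 0 < α) (hA : α * Fintype.card U ≤ A.card) : A.Nonempty := by
  have hU : (0 : ℝ) < Fintype.card U := by exact_mod_cast Fintype.card_pos
  rw [← Finset.card_pos]
  exact_mod_cast (mul_pos hα hU).trans_le hA

theorem Solves.descend {P : Protocol X Y Z} {r c k : ℕ} {α β : ℝ}
    (h : Solves ι P r c (k + 1) α β) : Solves ι P.swap r c k β α := by
  classical
  obtain ⟨A, S, φ, ψ, g, hA, hS, h⟩ := h
  rw [card_own_succ, Nat.card_eq_fintype_card] at hA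
  rw [card_oth_succ, Nat.card_eq_fintype_card] at hS
  obtain ⟨i, hi⟩ := exists_density_ownSlice (U := Oth ι k) A hA
  exact solves_subtree (A := A) (S := S) h i hi (density_image_eval S i hS)

/-- The non-owner, possibly just thinned out by a message, regains density `3 / 4` at the price of
`1 / 4` for the owner. At least `3 * (c + 3)` symbols have good slices, and `(3 / 4) ^ 3 < 1 / 2`,
so the projections at these symbols cannot all be below `3 / 4`. -/
theorem Solves.descend_dense {P : Protocol X Y Z} {r c k : ℕ} {α β : ℝ}
    (hc : 12 * (c + 3) ≤ Fintype.card ι) (hα : 0 ≤ α) (hβ : (1 / 4) / 2 ^ c ≤ β)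
    (h : Solves ι P r c (k + 1) (α + 1 / 4) β) : Solves ι P.swap r c k (3 / 4) α := by
  classical
  obtain ⟨A, S, φ, ψ, g, hA, hS, h⟩ := h
  rw [card_own_succ, Nat.card_eq_fintype_card] at hA
  rw [card_oth_succ, Nat.card_eq_fintype_card] at hS
  have hI := card_density_ownSlice (U := Oth ι k) A hα hA
  set I := Finset.univ.filter fun i =>
    α * Fintype.card (Oth ι k) ≤ ((ownSlice (U := Oth ι k) A i).card : ℝ)
  have hI' : 3 * (c + 3) ≤ I.card := by
    have h1 : (12 * (c + 3) : ℝ) ≤ Fintype.card ι := by exact_mod_cast hc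
    have h2 : (3 * (c + 3) : ℝ) ≤ I.card := by linarith
    exact_mod_cast h2
  have hpow : (3 / 4 : ℝ) ^ I.card < β := by
    refine lt_of_lt_of_le ?_ hβ
    calc (3 / 4 : ℝ) ^ I.card ≤ (3 / 4) ^ (3 * (c + 3)) :=
          pow_le_pow_of_le_one (by norm_num) (by norm_num) hI'
      _ = ((3 / 4) ^ 3) ^ (c + 3) := pow_mul _ _ _
      _ ≤ (1 / 2) ^ (c + 3) := by gcongr; norm_num
      _ = (1 / 8) / 2 ^ c := by rw [pow_add, one_div_pow]; ring
      _ < (1 / 4) / 2 ^ c := by gcongr; norm_num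
  obtain ⟨i, hi, hiS⟩ := exists_density_image_eval S I hpow hS
  exact solves_subtree (A := A) (S := S) h i (Finset.mem_filter.1 hi).2 hiS

/-- A constant answer fixes the root pointer, but one symbol out of at least two carries density at
most `1 / 2 < 3 / 4`. -/
theorem not_solves_answer {z : Z} {r c k : ℕ} {β : ℝ} (hι : 2 ≤ Fintype.card ι) (hβ : 0 < β) :
    ¬ Solves ι (Protocol.answer z : Protocol X Y Z) r c (k + 1) (3 / 4) β := by
  classical
  rintro ⟨A, S, φ, ψ, g, hA, hS, h⟩
  obtain ⟨b, hb⟩ := nonempty_of_density hβ hS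
  rw [card_own_succ, Nat.card_eq_fintype_card] at hA
  have hsum := density_le_sum_ownSlice (U := Oth ι k) A hA
  have hU : (0 : ℝ) < Fintype.card (Oth ι k) := by exact_mod_cast Fintype.card_pos
  have hι' : (2 : ℝ) ≤ Fintype.card ι := by exact_mod_cast hι
  obtain ⟨j, hj⟩ : ∃ j : ι, ∀ a ∈ A, Prod.fst (α := ι) (β := ι → Oth ι k) a = j := by
    obtain ⟨a₀, ha₀⟩ := nonempty_of_density (U := ι × (ι → Oth ι k)) (by norm_num) hA
    refine ⟨Prod.fst (α := ι) (β := ι → Oth ι k) a₀, fun a ha => ?_⟩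
    have h1 := (h a ha b hb).1.symm.trans (h a₀ ha₀ b hb).1
    exact (List.cons.inj h1).1
  have hle : ∑ i, ((ownSlice (U := Oth ι k) A i).card : ℝ) ≤
      ∑ i, if i = j then (Fintype.card (Oth ι k) : ℝ) else 0 := by
    refine Finset.sum_le_sum fun i _ => ?_
    split_ifs with hij
    · exact_mod_cast Finset.card_le_univ _
    · have : ownSlice (U := Oth ι k) A i = ∅ := by
        rw [Finset.eq_empty_iff_forall_notMem]
        intro u hu
        obtain ⟨x, hx, -⟩ := mem_ownSlice.1 hu
        exact hij (hj _ hx)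
      simp [this]
  rw [Finset.sum_ite_eq' Finset.univ j, if_pos (Finset.mem_univ j)] at hle
  nlinarith

/-- Restrict the sender to the most popular message. Positive densities supply an input pair, on
which the bounds force `r ≥ 1` and `b ≤ c`. -/
theorem Solves.alice {b : ℕ} {msg : X → (Fin b → Bool)}
    {next : (Fin b → Bool) → Protocol X Y Z} {r c k : ℕ} {α β : ℝ} (hα : 0 < α) (hβ : 0 < β)
    (h : Solves ι (Protocol.alice b msg next) r c k α β) :
    ∃ r', r = r' + 1 ∧ ∃ m, Solves ι (next m) r' c k (α / 2 ^ c) β := by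
  classical
  obtain ⟨A, S, φ, ψ, g, hA, hS, h⟩ := h
  obtain ⟨a₀, ha₀⟩ := nonempty_of_density hα hA
  obtain ⟨b₀, hb₀⟩ := nonempty_of_density hβ hS
  obtain ⟨-, h1, h2⟩ := h a₀ ha₀ b₀ hb₀
  obtain ⟨r', rfl⟩ : ∃ r', r = r' + 1 := ⟨r - 1, by simp only [Protocol.rounds] at h1; omega⟩
  obtain ⟨m, hm⟩ := exists_card_fiber_ge A ((le_max_left _ _).trans h2) fun a => msg (φ a)
  refine ⟨r', rfl, m, A.filter fun a => msg (φ a) = m, S, φ, ψ, g, ?_, hS, fun a ha b hb => ?_⟩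
  · refine le_trans ?_ hm
    rw [div_mul_eq_mul_div]
    gcongr
  · obtain ⟨haA, ham⟩ := Finset.mem_filter.1 ha
    obtain ⟨h3, h4, h5⟩ := h a haA b hb
    simp only [Protocol.output, Protocol.rounds, Protocol.maxBits, ham] at h3 h4 h5
    exact ⟨h3, by omega, (le_max_right _ _).trans h5⟩

theorem Solves.bob {b : ℕ} {msg : Y → (Fin b → Bool)}
    {next : (Fin b → Bool) → Protocol X Y Z} {r c k : ℕ} {α β : ℝ} (hα : 0 < α) (hβ : 0 < β)
    (h : Solves ι (Protocol.bob b msg next) r c k α β) :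
    ∃ r', r = r' + 1 ∧ ∃ m, Solves ι (next m) r' c k α (β / 2 ^ c) := by
  classical
  obtain ⟨A, S, φ, ψ, g, hA, hS, h⟩ := h
  obtain ⟨a₀, ha₀⟩ := nonempty_of_density hα hA
  obtain ⟨b₀, hb₀⟩ := nonempty_of_density hβ hS
  obtain ⟨-, h1, h2⟩ := h a₀ ha₀ b₀ hb₀
  obtain ⟨r', rfl⟩ : ∃ r', r = r' + 1 := ⟨r - 1, by simp only [Protocol.rounds] at h1; omega⟩
  obtain ⟨m, hm⟩ := exists_card_fiber_ge S ((le_max_left _ _).trans h2) fun y => msg (ψ y)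
  refine ⟨r', rfl, m, A, S.filter fun y => msg (ψ y) = m, φ, ψ, g, hA, ?_, fun a ha b hb => ?_⟩
  · refine le_trans ?_ hm
    rw [div_mul_eq_mul_div]
    gcongr
  · obtain ⟨hbS, hbm⟩ := Finset.mem_filter.1 hb
    obtain ⟨h3, h4, h5⟩ := h a ha b hbS
    simp only [Protocol.output, Protocol.rounds, Protocol.maxBits, hbm] at h3 h4 h5
    exact ⟨h3, by omega, (le_max_right _ _).trans h5⟩

/-- Tree pointer jumping with more than `3 * r` levels over an alphabet of size at least
`12 * (c + 3)` cannot be solved in `r` rounds of `c` bits, even on a dense rectangle. -/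
theorem not_solves {c : ℕ} (hc : 12 * (c + 3) ≤ Fintype.card ι) (r : ℕ) :
    ∀ {X Y Z : Type} (P : Protocol X Y Z) (k : ℕ), 3 * r + 1 ≤ k →
      ¬ Solves ι P r c k (3 / 4) (1 / 2) := by
  induction r with
  | zero =>
    intro X Y Z P k hk h
    obtain ⟨k, rfl⟩ : ∃ k', k = k' + 1 := ⟨k - 1, by omega⟩
    cases P with
    | answer z => exact not_solves_answer (by omega) (by norm_num) h
    | alice b msg next =>
      obtain ⟨r', hr', -⟩ := h.alice (by norm_num) (by norm_num)
      omega
    | bob b msg next =>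
      obtain ⟨r', hr', -⟩ := h.bob (by norm_num) (by norm_num)
      omega
  | succ r ih =>
    intro X Y Z P k hk h
    have hpos : (0 : ℝ) < 2 ^ c := by positivity
    have hone : (1 : ℝ) ≤ 2 ^ c := one_le_pow₀ one_le_two
    obtain ⟨k, rfl⟩ : ∃ k', k = k' + 3 := ⟨k - 3, by omega⟩
    cases P with
    | answer z => exact not_solves_answer (by omega) (by norm_num) h
    | alice b msg next =>
      obtain ⟨r', hr', m, h1⟩ := h.alice (by norm_num) (by norm_num)
      obtain rfl : r = r' := by omega
      -- The owner spoke. The densities (owner, other) run from `(3/4 / 2^c, 1/2)` through `(1/2,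
      -- 3/4 / 2^c)` and `(3/4, 1/4)` back to `(3/4, 1/2)`. The first descent only turns the thinned
      -- player into the non-owner.
      have h2 := h1.descend
      rw [show (1 / 2 : ℝ) = 1 / 4 + 1 / 4 by norm_num] at h2
      have h3 := h2.descend_dense hc (by norm_num) (by gcongr; norm_num)
      rw [show (3 / 4 : ℝ) = 1 / 2 + 1 / 4 by norm_num] at h3
      have h4 := h3.descend_dense hc (by norm_num) (div_le_self (by norm_num) hone)
      exact ih _ k (by omega) h4
    | bob b msg next =>
      obtain ⟨r', hr', m, h1⟩ := h.bob (by norm_num) (by norm_num)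
      obtain rfl : r = r' := by omega
      -- The non-owner spoke, and a single level restores `(3/4, 1/2)`.
      rw [show (3 / 4 : ℝ) = 1 / 2 + 1 / 4 by norm_num] at h1
      have h2 := h1.descend_dense hc (by norm_num) (by gcongr; norm_num)
      exact ih _ (k + 2) (by omega) h2

-- Embedding pointer jumping into Strategy

/-- The path of length `d` in the infinite binary tree whose vertices are lists of directions, when
the direction taken at the vertex `l` is `F l`. -/
def walk (F : List Bool → Bool) : ℕ → List Bool
  | 0 => []
  | d + 1 => walk F d ++ [F (walk F d)]

theorem length_walk (F : List Bool → Bool) (d : ℕ) : (walk F d).length = d := by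
  induction d with
  | zero => rfl
  | succ d ih => simp [walk, ih]

theorem walk_add (F : List Bool → Bool) (m n : ℕ) :
    walk F (m + n) = walk F m ++ walk (fun l => F (walk F m ++ l)) n := by
  induction n with
  | zero => simp [walk]
  | succ n ih => rw [← add_assoc, walk, ih]; simp [walk]

theorem getD_walk (F : List Bool → Bool) {j d : ℕ} (h : j < d) :
    (walk F d).getD j false = F (walk F j) := by
  obtain ⟨n, rfl⟩ : ∃ n, d = j + 1 + n := ⟨d - (j + 1), by omega⟩
  rw [walk_add, List.getD_append _ _ _ _ (by simp [length_walk]), walk,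
    List.getD_append_right _ _ _ _ (by simp [length_walk])]
  simp [length_walk]

theorem walk_congr {F G : List Bool → Bool} (h : ∀ l, F l = G l) (d : ℕ) : walk F d = walk G d := by
  rw [funext h]

variable {s : ℕ}

/-- The symbol encoded by the directions at the even positions of a block of length `2 * s + 1`. -/
def blockSymbol (s : ℕ) (l : List Bool) : Fin (s + 1) → Bool := fun j => l.getD (2 * j) false

/-- The decoding of `k` consecutive blocks. -/
def blockSymbols (s : ℕ) : ℕ → List Bool → List (Fin (s + 1) → Bool)
  | 0, _ => []
  | k + 1, l => blockSymbol s (l.take (2 * s + 1)) :: blockSymbols s k (l.drop (2 * s + 1))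

mutual
/-- The bits at the vertices of even depth encoding the pointers of the owner of the root. -/
def ownBit (s : ℕ) : (k : ℕ) → Own (Fin (s + 1) → Bool) k → List Bool → Bool
  | 0, _, _ => false
  | k + 1, a, l =>
      let a' : (Fin (s + 1) → Bool) × ((Fin (s + 1) → Bool) → Oth (Fin (s + 1) → Bool) k) := a
      -- Only the depth matters inside a block; `l.length / 2 ≤ s`, so `Fin.ofNat` does not wrap
      -- around.
      if l.length < 2 * s + 1 then a'.1 (Fin.ofNat (s + 1) (l.length / 2))
      else othBit s k (a'.2 (blockSymbol s (l.take (2 * s + 1)))) (l.drop (2 * s + 1))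
/-- The bits at the vertices of odd depth encoding the pointers of the other player. -/
def othBit (s : ℕ) : (k : ℕ) → Oth (Fin (s + 1) → Bool) k → List Bool → Bool
  | 0, _, _ => false
  | k + 1, b, l =>
      let b' : (Fin (s + 1) → Bool) → Own (Fin (s + 1) → Bool) k := b
      if l.length < 2 * s + 1 then false
      else ownBit s k (b' (blockSymbol s (l.take (2 * s + 1)))) (l.drop (2 * s + 1))
end

/-- The directions prescribed by the two encodings together. -/
def encode (s k : ℕ) (a : Own (Fin (s + 1) → Bool) k) (b : Oth (Fin (s + 1) → Bool) k)
    (l : List Bool) : Bool :=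
  if Even l.length then ownBit s k a l else othBit s k b l

theorem encode_of_length_lt {k : ℕ} (p : Fin (s + 1) → Bool)
    (x : (Fin (s + 1) → Bool) → Oth (Fin (s + 1) → Bool) k)
    (b : Oth (Fin (s + 1) → Bool) (k + 1)) {l : List Bool} (hl : Even l.length)
    (hs : l.length < 2 * s + 1) :
    encode s (k + 1) (p, x) b l =
      p (Fin.ofNat (s + 1) (l.length / 2)) :=
  (if_pos hl).trans (if_pos hs)

/-- The block length is odd, so crossing a block flips the parity of the depth and exchanges the
owners, as in the recursion for `Own` and `Oth`. -/
theorem encode_append {k : ℕ} (p : Fin (s + 1) → Bool)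
    (x : (Fin (s + 1) → Bool) → Oth (Fin (s + 1) → Bool) k)
    (b : (Fin (s + 1) → Bool) → Own (Fin (s + 1) → Bool) k) {w : List Bool}
    (hw : w.length = 2 * s + 1) (l : List Bool) :
    encode s (k + 1) (p, x) b (w ++ l) =
      encode s k (b (blockSymbol s w)) (x (blockSymbol s w)) l := by
  have hlen : ¬ (w ++ l).length < 2 * s + 1 := by rw [List.length_append]; omega
  have hodd : Even (w ++ l).length ↔ ¬ Even l.length := by
    rw [List.length_append, hw, Nat.even_add]
    simp
  by_cases hl : Even l.length
  · refine (if_neg (by rw [hodd]; simpa using hl)).trans ((if_neg hlen).trans ?_)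
    rw [List.take_left' hw, List.drop_left' hw, encode, if_pos hl]
  · refine (if_pos (hodd.2 hl)).trans ((if_neg hlen).trans ?_)
    rw [List.take_left' hw, List.drop_left' hw, encode, if_neg hl]

theorem blockSymbols_walk_encode (k n : ℕ) (hn : (2 * s + 1) * k ≤ n)
    (a : Own (Fin (s + 1) → Bool) k) (b : Oth (Fin (s + 1) → Bool) k) :
    blockSymbols s k (walk (encode s k a b) n) = eval k a b := by
  induction k generalizing n with
  | zero => rfl
  | succ k ih =>
    obtain ⟨n, rfl⟩ : ∃ n', n = 2 * s + 1 + n' := ⟨n - (2 * s + 1), by rw [mul_add] at hn; omega⟩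
    obtain ⟨p, x⟩ : (Fin (s + 1) → Bool) × ((Fin (s + 1) → Bool) → Oth (Fin (s + 1) → Bool) k) := a
    change (Fin (s + 1) → Bool) → Own (Fin (s + 1) → Bool) k at b
    set F := encode s (k + 1) (p, x) b
    have hlen := length_walk F (2 * s + 1)
    have hp : blockSymbol s (walk F (2 * s + 1)) = p := by
      funext j
      have hj := j.isLt
      rw [blockSymbol, getD_walk _ (by omega)]
      refine (encode_of_length_lt p x b (by simp [length_walk])
        (by rw [length_walk]; omega)).trans ?_
      rw [length_walk]
      congr 1
      ext
      simp
    have hsub : ∀ l, F (walk F (2 * s + 1) ++ l) = encode s k (b p) (x p) l := by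
      intro l
      refine (encode_append p x b hlen l).trans ?_
      rw [hp]
    rw [walk_add, blockSymbols, List.take_left' hlen, List.drop_left' hlen, hp,
      walk_congr hsub, ih n (by rw [mul_add] at hn; omega)]
    rfl

/-- The `d` lowest binary digits of `i`, the most significant one first. -/
def digitList : ℕ → ℕ → List Bool
  | 0, _ => []
  | d + 1, i => digitList d (i / 2) ++ [decide (i % 2 = 1)]

theorem length_digitList (d i : ℕ) : (digitList d i).length = d := by
  induction d generalizing i with
  | zero => rfl
  | succ d ih => simp [digitList, ih]

theorem digitList_succ (d i : ℕ) (t : Bool) :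
    digitList (d + 1) (2 * i + t.toNat) = digitList d i ++ [t] := by
  have h1 : (2 * i + t.toNat) / 2 = i := by have := t.toNat_le; cases t <;> simp; omega
  rw [digitList, h1]
  cases t <;> simp [Nat.add_mod]

theorem digitList_pathVertex {h : ℕ} (F : List Bool → Bool) (d : ℕ) (hd : d ≤ h) :
    digitList d (Strategy.pathVertex (h := h) (fun v => F (digitList v.1 v.2)) d hd) =
      walk F d := by
  induction d with
  | zero => rfl
  | succ d ih =>
    have h1 := ih (Nat.le_of_succ_le hd)
    set i := Strategy.pathVertex (h := h) (fun v => F (digitList v.1 v.2)) d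
      (Nat.le_of_succ_le hd)
    change digitList (d + 1) (2 * i + (F (digitList d i)).toNat) = _
    rw [digitList_succ, h1, walk]

/-- The swap is there because Bob holds the root, at depth `0`. Each player computes the encoding
from their own input; the rectangle is the full one. -/
theorem solves_of_solvedBy {h r c k : ℕ} (hk : (2 * s + 1) * k ≤ h)
    {P : Protocol (Strategy.AliceInput h) (Strategy.BobInput h) (Fin (2 ^ h))}
    (hP : Strategy.SolvedBy h P r c) :
    Solves (Fin (s + 1) → Bool) P.swap r c k (3 / 4) (1 / 2) := by
  refine ⟨Finset.univ, Finset.univ, fun a v => ownBit s k a (digitList v.1.1 v.1.2),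
    fun b v => othBit s k b (digitList v.1.1 v.1.2), fun z => blockSymbols s k (digitList h z),
    ?_, ?_, fun a _ b _ => ?_⟩
  · rw [Finset.card_univ]
    have : (0 : ℝ) ≤ Fintype.card (Own (Fin (s + 1) → Bool) k) := by positivity
    linarith
  · rw [Finset.card_univ]
    have : (0 : ℝ) ≤ Fintype.card (Oth (Fin (s + 1) → Bool) k) := by positivity
    linarith
  · have h1 := hP fun v => encode s k a b (digitList v.1 v.2)
    have hA : Strategy.aliceView (h := h) (fun v => encode s k a b (digitList v.1 v.2)) =
        fun v => othBit s k b (digitList v.1.1 v.1.2) := by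
      funext v
      simp only [Strategy.aliceView, encode, length_digitList]
      rw [if_neg (Nat.not_even_iff_odd.2 v.2)]
    have hB : Strategy.bobView (h := h) (fun v => encode s k a b (digitList v.1 v.2)) =
        fun v => ownBit s k a (digitList v.1.1 v.1.2) := by
      funext v
      simp only [Strategy.bobView, encode, length_digitList]
      rw [if_pos v.2]
    rw [hA, hB] at h1
    rw [Protocol.output_swap, Protocol.rounds_swap, Protocol.maxBits_swap]
    refine ⟨?_, h1.2⟩
    rw [h1.1, Strategy.leafReached]
    change blockSymbols s k (digitList h _) = _
    rw [digitList_pathVertex (encode s k a b) h le_rfl, blockSymbols_walk_encode k h hk]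

/-- A protocol solving Strategy on the tree of height `h` in `r` rounds of `c` bits requires
`h < (2 * s + 1) * (3 * r + 1)` as soon as `12 * (c + 3) ≤ 2 ^ (s + 1)`. -/
theorem lt_of_solvedBy {h r c : ℕ} (hc : 12 * (c + 3) ≤ 2 ^ (s + 1))
    {P : Protocol (Strategy.AliceInput h) (Strategy.BobInput h) (Fin (2 ^ h))}
    (hP : Strategy.SolvedBy h P r c) : h < (2 * s + 1) * (3 * r + 1) := by
  by_contra! hk
  exact not_solves (by simpa using hc) r P.swap (3 * r + 1) le_rfl (solves_of_solvedBy hk hP)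

end PointerJumping

-- Asymptotics

namespace Strategy

theorem tendsto_log_size : Tendsto (fun h : ℕ => Real.log (size h : ℝ)) atTop atTop := by
  refine Real.tendsto_log_atTop.comp (tendsto_natCast_atTop_atTop.comp ?_)
  refine tendsto_atTop_mono (fun h => ?_) tendsto_id
  have := Nat.lt_two_pow_self (n := h + 1)
  rw [size_eq, id]
  omega

theorem log_size_le (h : ℕ) : Real.log (size h : ℝ) ≤ h + 1 := by
  have h1 : (size h : ℝ) ≤ 2 ^ (h + 1) := by
    rw [size_eq]
    exact_mod_cast Nat.sub_le _ _
  have h2 : (0 : ℝ) < size h := by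
    have := Nat.lt_two_pow_self (n := h + 1)
    rw [size_eq]
    exact_mod_cast (by omega : 0 < 2 ^ (h + 1) - 1)
  calc Real.log (size h : ℝ) ≤ Real.log (2 ^ (h + 1)) := Real.log_le_log h2 h1
    _ = (h + 1) * Real.log 2 := by rw [Real.log_pow]; push_cast; rfl
    _ ≤ (h + 1) * 1 := by
        gcongr
        linarith [Real.log_two_lt_d9]
    _ = h + 1 := mul_one _

/-- If `c = O(L)` with `L → ∞`, then a block length `s` with `2 ^ s = O(c)` is `O(log L)`. -/
theorem isBigO_blockLength {L : ℕ → ℝ} (hL : Tendsto L atTop atTop) {c : ℕ → ℕ}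
    (hc : (fun h => (c h : ℝ)) =O[atTop] L) :
    (fun h => ((2 * Nat.log 2 (12 * (c h + 3)) + 1 : ℕ) : ℝ)) =O[atTop]
      fun h => Real.log (L h) := by
  obtain ⟨C, hC, hc⟩ := hc.exists_pos
  refine IsBigO.of_bound 9 ?_
  filter_upwards [hc.bound, hL.eventually_ge_atTop (12 * C + 36),
    (Real.tendsto_log_atTop.comp hL).eventually_ge_atTop 1] with h h1 h2 h3
  simp only [Function.comp_apply] at h3
  have hL1 : 1 ≤ L h := by linarith
  rw [Real.norm_of_nonneg (by positivity), Real.norm_of_nonneg (by linarith)] at h1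
  rw [Real.norm_of_nonneg (by positivity), Real.norm_of_nonneg (by linarith)]
  have h5 : 2 ^ Nat.log 2 (12 * (c h + 3)) ≤ 12 * (c h + 3) := Nat.pow_log_le_self 2 (by omega)
  generalize Nat.log 2 (12 * (c h + 3)) = s at h5 ⊢
  -- `12 * (c + 3) ≤ (12 * C + 36) * L ≤ L ^ 2`. Hence `s ≤ 4 * log L`, and the constant `9` absorbs
  -- the `1` in `2 * s + 1`.
  have h4 : ((2 : ℝ) ^ s) ≤ L h ^ 2 := by
    have h6 : ((2 : ℝ) ^ s) ≤ 12 * (c h + 3) := by exact_mod_cast h5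
    nlinarith only [h1, h2, h6, hL1, hC]
  have h7 := Real.log_le_log (by positivity) h4
  rw [Real.log_pow, Real.log_pow] at h7
  have h8 : (s : ℝ) * (1 / 2) ≤ s * Real.log 2 := by
    gcongr
    linarith [Real.log_two_gt_d9]
  push_cast at h7 ⊢
  linarith

theorem isLittleO_mul_of_rpow {L : ℕ → ℝ} (hL : Tendsto L atTop atTop) {ε : ℝ} (hε : 0 < ε)
    {u : ℕ → ℝ} {r : ℕ → ℕ} (hu : u =O[atTop] fun h => Real.log (L h))
    (hr : (fun h => (r h : ℝ)) =O[atTop] fun h => L h ^ (1 - ε)) :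
    (fun h => u h * ((3 * r h + 1 : ℕ) : ℝ)) =o[atTop] L := by
  -- Capping `ε` at `1` keeps the exponent `1 - δ` nonnegative, so that the `1` in `3 * r + 1` is
  -- absorbed.
  set δ := min ε 1 with hδ
  have hδ0 : 0 < δ := lt_min hε one_pos
  have hle : (fun h => L h ^ (1 - ε)) =O[atTop] fun h => L h ^ (1 - δ) := by
    refine IsBigO.of_bound 1 ?_
    filter_upwards [hL.eventually_ge_atTop 1] with h h1
    rw [Real.norm_of_nonneg (by positivity), Real.norm_of_nonneg (by positivity), one_mul]
    exact Real.rpow_le_rpow_of_exponent_le h1 (by linarith [min_le_left ε 1])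
  have hone : (fun _ : ℕ => (1 : ℝ)) =O[atTop] fun h => L h ^ (1 - δ) := by
    refine IsBigO.of_bound 1 ?_
    filter_upwards [hL.eventually_ge_atTop 1] with h h1
    rw [Real.norm_of_nonneg (by positivity), Real.norm_of_nonneg (by positivity), one_mul]
    exact Real.one_le_rpow h1 (by linarith [min_le_right ε 1])
  have hr' : (fun h => ((3 * r h + 1 : ℕ) : ℝ)) =O[atTop] fun h => L h ^ (1 - δ) := by
    push_cast
    exact ((hr.trans hle).const_mul_left 3).add hone
  have hu' : u =o[atTop] fun h => L h ^ δ :=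
    hu.trans_isLittleO ((isLittleO_log_rpow_atTop hδ0).comp_tendsto hL)
  refine (hu'.mul_isBigO hr').congr' EventuallyEq.rfl ?_
  filter_upwards [hL.eventually_gt_atTop 0] with h h1
  rw [← Real.rpow_add h1, add_sub_cancel, Real.rpow_one]

end Strategy

/-- There is no family of deterministic protocols solving Strategy of size `n` in
`O((log n) ^ (1 - ε))` rounds with `O(log n)` bits of communication at each round. -/
theorem theorem3 (ε : ℝ) (hε : 0 < ε) :
    ¬ ∃ (P : ∀ h : ℕ,
          Protocol (Strategy.AliceInput h) (Strategy.BobInput h) (Fin (2 ^ h)))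
        (r c : ℕ → ℕ),
        (∀ h : ℕ, Strategy.SolvedBy h (P h) (r h) (c h)) ∧
        ((fun h : ℕ => (r h : ℝ)) =O[atTop]
          fun h : ℕ => (Real.log (Strategy.size h : ℝ)) ^ (1 - ε)) ∧
        ((fun h : ℕ => (c h : ℝ)) =O[atTop]
          fun h : ℕ => Real.log (Strategy.size h : ℝ)) := by
  rintro ⟨P, r, c, hP, hr, hc⟩
  have hL := Strategy.tendsto_log_size
  have key := Strategy.isLittleO_mul_of_rpow hL hε (Strategy.isBigO_blockLength hL hc) hr
  -- With the constant `1 / 2` the bounds give `h < (h + 1) / 2`, impossible for `h ≥ 1`.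
  obtain ⟨h, h1, h2, h3⟩ := ((key.bound (by norm_num : (0 : ℝ) < 1 / 2)).and
    ((hL.eventually_ge_atTop 0).and (eventually_ge_atTop 1))).exists
  rw [Real.norm_of_nonneg (by positivity), Real.norm_of_nonneg h2] at h1
  have h4 := PointerJumping.lt_of_solvedBy (s := Nat.log 2 (12 * (c h + 3)))
    (Nat.lt_pow_succ_log_self one_lt_two _).le (hP h)
  have h5 := Strategy.log_size_le h
  have h6 : (h : ℝ) < ((2 * Nat.log 2 (12 * (c h + 3)) + 1 : ℕ) : ℝ) * ((3 * r h + 1 : ℕ) : ℝ) := by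
    exact_mod_cast h4
  have h7 : (1 : ℝ) ≤ h := by exact_mod_cast h3
  linarith
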